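/- There are absolute constants $C_0, C_1 > 1$ such that the following holds for every transcendental entire function $f$ (that is, every entire function that is not a polynomial). For $r>0$ write $M(r)=\max_{|z|=r}|f(z)|$, $m(r)=\min_{|z|=r}|f(z)|$, \[ \lambda(r)=\frac12\left(\frac{M(2r)}{M(r)}-1\right),\qquad \varepsilon(r)=\frac{2C_1}{(C_1\lambda(r))^{1/C_0}}, \] and put $B(w,\rho)=\{z\in\mathbb{C}:|z-w|<\rho\}$ and $A(\rho,\sigma)=\{z\in\mathbb{C}:\rho<|z|<\sigma\}$. (a) If $r>0$ and there exists $s\in(2r,4r)$ with $m(s)\le 1$, then either \[ f(A(r,8r))\supset B(0,M(r)), \] or there exists $w_1\in B(0,M(r))$ such that \[ f(A(r,8r))\supset B(0,M(r))\setminus B\bigl(w_1,\varepsilon(r)\max\{|w_1|,1\}\bigr). \] (b) $\varepsilon(r)\to 0$ as $r\to\infty$. (c) There exists $R_2=R_2(f)>0$ such that if $r>R_2$, there exists $s\in(2r,4r)$ with $m(s)\le 1$, and $S,S',T,T'$ satisfy \[ 2<S<S',\qquad T<T'\le M(r),\qquad S'\le\tfrac12 T, \] then $f(A(r,8r))$ contains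 $A(S,S')$ or $A(T,T')$. -/

import Mathlib

open Filter Topology

noncomputable section

/-- A transcendental entire function: holomorphic on the whole plane and not a polynomial. -/
def IsTranscendentalEntire (f : ℂ → ℂ) : Prop :=
  Differentiable ℂ f ∧ ¬ ∃ p : Polynomial ℂ, ∀ z : ℂ, f z = p.eval z

/-- The maximum modulus `M(r) = max_{|z| = r} |f z|` (attained for continuous `f`, `r > 0`). -/
def maxModulus (f : ℂ → ℂ) (r : ℝ) : ℝ :=
  sSup ((fun z : ℂ => ‖f z‖) '' Metric.sphere (0 : ℂ) r)

/-- The minimum modulus `m(r) = min_{|z| = r} |f z|` (attained for continuous `f`, `r > 0`). -/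
def minModulus (f : ℂ → ℂ) (r : ℝ) : ℝ :=
  sInf ((fun z : ℂ => ‖f z‖) '' Metric.sphere (0 : ℂ) r)

/-- The open annulus `A(r, s) = {z : r < |z| < s}`. -/
def openAnnulus (r s : ℝ) : Set ℂ := {z : ℂ | r < ‖z‖ ∧ ‖z‖ < s}

/-- `λ(r) = (M(2r) / M(r) - 1) / 2`. -/
def coverLambda (f : ℂ → ℂ) (r : ℝ) : ℝ :=
  (1 / 2) * (maxModulus f (2 * r) / maxModulus f r - 1)

/-- `ε(r) = 2 C₁ / (C₁ λ(r)) ^ (1 / C₀)`. -/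
def coverEps (C₀ C₁ : ℝ) (f : ℂ → ℂ) (r : ℝ) : ℝ :=
  2 * C₁ / (C₁ * coverLambda f r) ^ (1 / C₀)

end

/-!
If `f` omits two values `w₁, w₂` of `B(0, M(r))` on `A(r, 8r)`, then `g = (f - w₁) / (w₂ - w₁)` is
holomorphic there and omits `0` and `1`. The circle `|z| = s` with `2r < s < 4r` lies well inside
the annulus, so Schottky's theorem, applied along a chain of discs
(`exists_log_two_add_norm_le_on_circle`), gives `|g z| ≤ (2 + |g ζ|) ^ K` for any two points of the
circle, with an absolute `K`. At a point where `|f| = m(s) ≤ 1` the value of `|g|` is at most `2 / ε`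
if `|w₂ - w₁| ≥ ε max(|w₁|, 1)`; at a point where `|f| = M(s) ≥ M(2r)` it is at least `λ(r)`. For
`ε = ε(r)` with `C₀ = K`, `C₁ = 16` these bounds contradict each other as long as `ε` is bounded,
say by `3`. That bound is automatic when `w₁` is chosen with modulus at least half that of every
other omitted value. This is `IsTranscendentalEntire.exists_ball_diff_ball_subset_image`.

Schottky's theorem with a polynomial bound (`exists_log_two_add_norm_le`) follows from Bloch's
theorem (`exists_ball_subset_image`): on a disc, `g = exp (2πi cosh² F)` where `F` omits a set that
is relatively dense in the plane, so that Bloch's theorem bounds the oscillation of `F` on the disc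
of half the radius, hence `log |g|` up to a constant factor.

That `ε(r) → 0` means `M(2r) / M(r) → ∞`. Splitting off a Taylor polynomial,
`f = p + z ^ (n + 1) g` with `g` entire and not identically zero, and the maximum modulus principle
for `g` gives `M(2r) ≥ 2 ^ n M(r)` for large `r`
(`IsTranscendentalEntire.eventually_two_pow_mul_maxModulus_le`). Finally, once `ε ≤ 1 / 8`, the
exceptional disc is too small to meet two annuli separated by a factor of two
(`openAnnulus_subset_or_of_ball_diff_ball_subset`).
-/

/-! ### Bloch's theorem -/

/-- If the derivative on a disc is at most twice its value at the centre, the image of the disc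
contains a disc of radius comparable to the radius times that value. By the Schwarz lemma for
`F'`, the map `F` is close to its linear part on a smaller disc, so it moves the boundary away from
`F z₀`. -/
lemma ball_subset_image_of_norm_deriv_le {F : ℂ → ℂ} {z₀ : ℂ} {t : ℝ} (ht : 0 < t)
    (hF : DifferentiableOn ℂ F (Metric.ball z₀ t))
    (h : ∀ z ∈ Metric.ball z₀ t, ‖deriv F z‖ ≤ 2 * ‖deriv F z₀‖) (h0 : deriv F z₀ ≠ 0) :
    Metric.ball (F z₀) (t * ‖deriv F z₀‖ / 24) ⊆ F '' Metric.ball z₀ t := by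
  set D := ‖deriv F z₀‖ with hD
  have hD0 : 0 < D := norm_pos_iff.mpr h0
  have hsub : Metric.closedBall z₀ (t / 6) ⊆ Metric.ball z₀ t :=
    Metric.closedBall_subset_ball (by linarith)
  have hdiff : ∀ z ∈ Metric.ball z₀ t, DifferentiableAt ℂ F z := fun z hz =>
    hF.differentiableAt (Metric.isOpen_ball.mem_nhds hz)
  have hmaps : Set.MapsTo (deriv F) (Metric.ball z₀ t)
      (Metric.closedBall (deriv F z₀) (3 * D)) := by
    intro z hz
    rw [mem_closedBall_iff_norm]
    linarith [norm_sub_le (deriv F z) (deriv F z₀), h z hz]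
  have hder : ∀ z ∈ Metric.closedBall z₀ (t / 6), ‖deriv F z - deriv F z₀‖ ≤ D / 2 := by
    intro z hz
    have h1 := Complex.dist_le_div_mul_dist_of_mapsTo_ball (hF.deriv Metric.isOpen_ball) hmaps
      (hsub hz)
    rw [Metric.mem_closedBall] at hz
    rw [← dist_eq_norm]
    calc _ ≤ _ := h1
      _ ≤ 3 * D / t * (t / 6) := by gcongr
      _ = D / 2 := by field_simp; norm_num
  have hbd : ∀ z ∈ Metric.sphere z₀ (t / 6), t * D / 12 ≤ ‖F z - F z₀‖ := by
    intro z hz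
    have hz' : ‖z - z₀‖ = t / 6 := by simpa [dist_eq_norm] using hz
    have hlin := Convex.norm_image_sub_le_of_norm_hasDerivWithin_le
      (f := fun z => F z - deriv F z₀ * z) (f' := fun z => deriv F z - deriv F z₀)
      (s := Metric.closedBall z₀ (t / 6)) (C := D / 2)
      (fun x hx => by
        have := (hdiff x (hsub hx)).hasDerivAt.fun_sub
          ((hasDerivAt_id x).const_mul (deriv F z₀))
        simpa using this.hasDerivWithinAt)
      hder (convex_closedBall _ _) (Metric.mem_closedBall_self (by positivity))
      (Metric.sphere_subset_closedBall hz)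
    have h2 : ‖deriv F z₀ * (z - z₀)‖ = D * (t / 6) := by rw [norm_mul, hz']
    have h3 : deriv F z₀ * (z - z₀) = (F z - F z₀) -
        (F z - deriv F z₀ * z - (F z₀ - deriv F z₀ * z₀)) := by ring
    have h4 := norm_sub_le (F z - F z₀) (F z - deriv F z₀ * z - (F z₀ - deriv F z₀ * z₀))
    rw [← h3, h2] at h4
    rw [hz'] at hlin
    linarith
  have hfreq : ∃ᶠ z in 𝓝 z₀, F z ≠ F z₀ :=
    ((hdiff z₀ (Metric.mem_ball_self ht)).hasDerivAt.eventually_ne h0).frequently.filter_mono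
      nhdsWithin_le_nhds
  have hcl : DiffContOnCl ℂ F (Metric.ball z₀ (t / 6)) :=
    (hF.mono (Metric.closure_ball_subset_closedBall.trans hsub)).diffContOnCl
  have := hcl.ball_subset_image_closedBall (by positivity) hbd hfreq
  have he : t * D / 12 / 2 = t * D / 24 := by ring
  rw [he] at this
  exact this.trans (Set.image_mono hsub)

/-- **Bloch's theorem**, with a non-optimal constant. -/
theorem exists_ball_subset_image {F : ℂ → ℂ} {b : ℂ} {ρ : ℝ} (hρ : 0 < ρ) {U : Set ℂ}
    (hU : IsOpen U) (hbU : Metric.closedBall b ρ ⊆ U) (hF : DifferentiableOn ℂ F U) :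
    ∃ w, Metric.ball w (ρ * ‖deriv F b‖ / 48) ⊆ F '' U := by
  rcases eq_or_ne (deriv F b) 0 with h0 | h0
  · exact ⟨0, by simp [h0]⟩
  have hcont : ContinuousOn (fun z => (ρ - ‖z - b‖) * ‖deriv F z‖) (Metric.closedBall b ρ) :=
    (by fun_prop : ContinuousOn (fun z => ρ - ‖z - b‖) _).mul
      (((hF.deriv hU).continuousOn.mono hbU).norm)
  -- The standard choice of `z₀`: maximize the weighted derivative, which vanishes on the boundary.
  obtain ⟨z₀, hz₀, hmax⟩ := (isCompact_closedBall b ρ).exists_isMaxOn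
    ⟨b, Metric.mem_closedBall_self hρ.le⟩ hcont
  have hb : ρ * ‖deriv F b‖ ≤ (ρ - ‖z₀ - b‖) * ‖deriv F z₀‖ := by
    simpa using hmax (Metric.mem_closedBall_self hρ.le)
  have hpos : 0 < (ρ - ‖z₀ - b‖) * ‖deriv F z₀‖ :=
    lt_of_lt_of_le (mul_pos hρ (norm_pos_iff.mpr h0)) hb
  have h0' : deriv F z₀ ≠ 0 := by rintro h; simp [h] at hpos
  have ht : 0 < ρ - ‖z₀ - b‖ := pos_of_mul_pos_left hpos (norm_nonneg _)
  set t := (ρ - ‖z₀ - b‖) / 2 with htdef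
  have hball : Metric.ball z₀ t ⊆ Metric.closedBall b ρ := by
    intro z hz
    rw [mem_ball_iff_norm] at hz
    rw [mem_closedBall_iff_norm]
    have : ‖z - b‖ ≤ ‖z - z₀‖ + ‖z₀ - b‖ := norm_sub_le_norm_sub_add_norm_sub ..
    linarith
  have hder : ∀ z ∈ Metric.ball z₀ t, ‖deriv F z‖ ≤ 2 * ‖deriv F z₀‖ := by
    intro z hz
    have h1 : (ρ - ‖z - b‖) * ‖deriv F z‖ ≤ (ρ - ‖z₀ - b‖) * ‖deriv F z₀‖ := hmax (hball hz)
    rw [mem_ball_iff_norm] at hz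
    have : ‖z - b‖ ≤ ‖z - z₀‖ + ‖z₀ - b‖ := norm_sub_le_norm_sub_add_norm_sub ..
    have h2 : t * ‖deriv F z‖ ≤ t * (2 * ‖deriv F z₀‖) := by
      calc t * ‖deriv F z‖ ≤ (ρ - ‖z - b‖) * ‖deriv F z‖ := by gcongr; linarith
        _ ≤ _ := h1
        _ = _ := by rw [htdef]; ring
    exact le_of_mul_le_mul_left h2 (by linarith)
  refine ⟨F z₀, (Metric.ball_subset_ball ?_).trans
    ((ball_subset_image_of_norm_deriv_le (by linarith)
      (hF.mono (hball.trans hbU)) hder h0').trans (Set.image_mono (hball.trans hbU)))⟩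
  rw [htdef]; linarith

/-! ### Schottky's theorem with a polynomial bound -/

/-- A zero-free holomorphic function on a disc has a holomorphic logarithm. -/
lemma exists_differentiableOn_exp_eq {g : ℂ → ℂ} {a : ℂ} {ρ : ℝ}
    (hg : DifferentiableOn ℂ g (Metric.ball a ρ)) (h0 : ∀ z ∈ Metric.ball a ρ, g z ≠ 0) :
    ∃ L : ℂ → ℂ, DifferentiableOn ℂ L (Metric.ball a ρ) ∧
      ∀ z ∈ Metric.ball a ρ, Complex.exp (L z) = g z := by
  rcases le_or_gt ρ 0 with hρ | hρ
  · exact ⟨0, by simp [Metric.ball_eq_empty.mpr hρ], by simp [Metric.ball_eq_empty.mpr hρ]⟩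
  obtain ⟨L, hLa, hL⟩ := ((hg.deriv Metric.isOpen_ball).div hg h0).isExactOn_ball.with_val_at a
    (Complex.log (g a))
  have ha : a ∈ Metric.ball a ρ := Metric.mem_ball_self hρ
  have hLd : DifferentiableOn ℂ L (Metric.ball a ρ) := fun z hz =>
    (hL z hz).differentiableAt.differentiableWithinAt
  refine ⟨L, hLd, fun z hz => ?_⟩
  have hder : ∀ z ∈ Metric.ball a ρ, HasDerivAt (fun z => g z * Complex.exp (-L z)) 0 z := by
    intro z hz
    have hgz := (hg.differentiableAt (Metric.isOpen_ball.mem_nhds hz)).hasDerivAt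
    have h := hgz.fun_mul (hL z hz).fun_neg.cexp
    have he : deriv g z * Complex.exp (-L z) +
        g z * (Complex.exp (-L z) * -((deriv g / g) z)) = 0 := by
      have := h0 z hz
      simp only [Pi.div_apply]
      field_simp
      ring
    rwa [he] at h
  have hconst := Metric.isOpen_ball.is_const_of_deriv_eq_zero (convex_ball a ρ).isPreconnected
    (fun z hz => (hder z hz).differentiableAt.differentiableWithinAt)
    (fun z hz => (hder z hz).deriv) hz ha
  simp only [hLa, Complex.exp_neg, Complex.exp_log (h0 a ha), mul_inv_cancel₀ (h0 a ha)] at hconst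
  exact ((mul_inv_eq_one₀ (Complex.exp_ne_zero _)).mp hconst).symm

/-- If a holomorphic `H` on a disc omits `0` and `1`, then `H = cosh² F` for a holomorphic `F`:
with `u² = H` and `v² = H - 1` one has `(u - v) (u + v) = 1`, and `u - v = exp F` gives
`u = cosh F`. -/
lemma exists_differentiableOn_cosh_sq_eq {H : ℂ → ℂ} {a : ℂ} {ρ : ℝ}
    (hH : DifferentiableOn ℂ H (Metric.ball a ρ)) (h0 : ∀ z ∈ Metric.ball a ρ, H z ≠ 0)
    (h1 : ∀ z ∈ Metric.ball a ρ, H z ≠ 1) :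
    ∃ F : ℂ → ℂ, DifferentiableOn ℂ F (Metric.ball a ρ) ∧
      ∀ z ∈ Metric.ball a ρ, Complex.cosh (F z) ^ 2 = H z := by
  obtain ⟨L, hLd, hL⟩ := exists_differentiableOn_exp_eq hH h0
  obtain ⟨L', hLd', hL'⟩ := exists_differentiableOn_exp_eq (g := fun z => H z - 1)
    (hH.sub_const 1) (fun z hz => sub_ne_zero.mpr (h1 z hz))
  have hu : ∀ z ∈ Metric.ball a ρ, Complex.exp (L z / 2) ^ 2 = H z := fun z hz => by
    rw [← Complex.exp_nat_mul, ← hL z hz]; congr 1; push_cast; ring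
  have hv : ∀ z ∈ Metric.ball a ρ, Complex.exp (L' z / 2) ^ 2 = H z - 1 := fun z hz => by
    rw [← Complex.exp_nat_mul, ← hL' z hz]; congr 1; push_cast; ring
  have hprod : ∀ z ∈ Metric.ball a ρ, (Complex.exp (L z / 2) - Complex.exp (L' z / 2)) *
      (Complex.exp (L z / 2) + Complex.exp (L' z / 2)) = 1 := fun z hz => by
    linear_combination hu z hz - hv z hz
  obtain ⟨F, hFd, hF⟩ := exists_differentiableOn_exp_eq
    (g := fun z => Complex.exp (L z / 2) - Complex.exp (L' z / 2))
    ((hLd.div_const 2).cexp.sub (hLd'.div_const 2).cexp)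
    (fun z hz => left_ne_zero_of_mul_eq_one (hprod z hz))
  refine ⟨F, hFd, fun z hz => ?_⟩
  have hneg : Complex.exp (-F z) = Complex.exp (L z / 2) + Complex.exp (L' z / 2) := by
    rw [Complex.exp_neg, hF z hz]
    exact (eq_inv_of_mul_eq_one_right (hprod z hz)).symm
  have : Complex.cosh (F z) = Complex.exp (L z / 2) := by
    rw [Complex.cosh, hneg, hF z hz]; ring
  rw [this, hu z hz]

/-- Integer values of `cosh²` are taken at bounded distance from every point of the plane. -/
lemma exists_cosh_sq_eq_intCast (w : ℂ) :
    ∃ w' : ℂ, ‖w' - w‖ < 3 ∧ ∃ n : ℤ, Complex.cosh w' ^ 2 = n := by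
  have key : ∀ X : ℝ, 0 ≤ X → ∃ x : ℝ, |x - X| ≤ 1 ∧ ∃ n : ℤ, Real.cosh x ^ 2 = n := by
    intro X hX
    have hgap : Real.cosh X ^ 2 + 1 ≤ Real.cosh (X + 1) ^ 2 := by
      have h1 : (1 : ℝ) ≤ Real.sinh 1 := Real.self_le_sinh_iff.mpr zero_le_one
      have h2 : (1 : ℝ) ≤ Real.cosh 1 := Real.one_le_cosh 1
      have h3 : (0 : ℝ) ≤ Real.sinh X := Real.sinh_nonneg_iff.mpr hX
      have h4 : (1 : ℝ) ≤ Real.cosh X := Real.one_le_cosh X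
      have h5 := Real.cosh_sq 1
      rw [Real.cosh_add]
      have h6 : Real.cosh X * Real.cosh 1 ≤
          Real.cosh X * Real.cosh 1 + Real.sinh X * Real.sinh 1 := by
        have : 0 ≤ Real.sinh X * Real.sinh 1 := by positivity
        linarith
      calc Real.cosh X ^ 2 + 1 ≤ Real.cosh X ^ 2 + Real.cosh X ^ 2 * Real.sinh 1 ^ 2 := by
            nlinarith [one_le_pow₀ h4 (n := 2), one_le_pow₀ h1 (n := 2)]
        _ = (Real.cosh X * Real.cosh 1) ^ 2 := by rw [mul_pow, h5]; ring
        _ ≤ _ := pow_le_pow_left₀ (by positivity) h6 2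
    obtain ⟨x, hx, hxn⟩ := intermediate_value_Icc (by linarith : X ≤ X + 1)
      (f := fun x => Real.cosh x ^ 2) (by fun_prop)
      (show ((⌈Real.cosh X ^ 2⌉ : ℤ) : ℝ) ∈ Set.Icc (Real.cosh X ^ 2) (Real.cosh (X + 1) ^ 2) from
        ⟨Int.le_ceil _, (Int.ceil_lt_add_one _).le.trans hgap⟩)
    exact ⟨x, by rw [abs_le]; constructor <;> linarith [hx.1, hx.2], _, hxn⟩
  have key' : ∃ x : ℝ, |x - w.re| ≤ 1 ∧ ∃ n : ℤ, Real.cosh x ^ 2 = n := by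
    rcases le_total 0 w.re with h | h
    · exact key _ h
    · obtain ⟨x, hx, n, hn⟩ := key (-w.re) (by linarith)
      refine ⟨-x, ?_, n, by rwa [Real.cosh_neg]⟩
      rw [← abs_neg]; convert hx using 2; ring
  obtain ⟨x, hx, n, hn⟩ := key'
  set m : ℤ := round (w.im / Real.pi)
  have hm : |m * Real.pi - w.im| ≤ Real.pi / 2 := by
    have h := abs_sub_round (w.im / Real.pi)
    have : m * Real.pi - w.im = -((w.im / Real.pi - m) * Real.pi) := by
      field_simp [Real.pi_ne_zero]; ring
    rw [this, abs_neg, abs_mul, abs_of_pos Real.pi_pos]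
    nlinarith [Real.pi_pos]
  refine ⟨⟨x, m * Real.pi⟩, ?_, n, ?_⟩
  · refine (Complex.norm_le_abs_re_add_abs_im _).trans_lt ?_
    simp only [Complex.sub_re, Complex.sub_im]
    linarith [Real.pi_lt_d2]
  · have he : (⟨x, m * Real.pi⟩ : ℂ) = x + (m * Real.pi : ℂ) * Complex.I := by
      apply Complex.ext <;> simp
    have hs : Complex.sin (m * Real.pi) = 0 := Complex.sin_int_mul_pi m
    have hc : Complex.cos (m * Real.pi) ^ 2 = 1 := by
      have := Complex.sin_sq_add_cos_sq (m * Real.pi)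
      rw [hs] at this; simpa using this
    rw [he, Complex.cosh_add, Complex.cosh_mul_I, Complex.sinh_mul_I, hs]
    simp only [zero_mul, mul_zero, add_zero, mul_pow, hc, mul_one]
    rw [← Complex.ofReal_cosh]
    exact_mod_cast hn

/-- Landau's estimate: a holomorphic `F` on a disc, none of whose values has an integral `cosh²`,
varies by a bounded amount on the concentric disc of half the radius, because by Bloch's theorem
its derivative is controlled by the size of the discs in its image. -/
lemma norm_sub_le_of_cosh_sq_ne_intCast {F : ℂ → ℂ} {a : ℂ} {ρ : ℝ} (hρ : 0 < ρ)
    (hF : DifferentiableOn ℂ F (Metric.ball a ρ))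
    (homit : ∀ z ∈ Metric.ball a ρ, ∀ n : ℤ, Complex.cosh (F z) ^ 2 ≠ n) :
    ∀ z ∈ Metric.closedBall a (ρ / 2), ‖F z - F a‖ ≤ 216 := by
  have hder : ∀ b ∈ Metric.closedBall a (ρ / 2), ‖deriv F b‖ ≤ 432 / ρ := by
    intro b hb
    have hsub : Metric.closedBall b (ρ / 3) ⊆ Metric.ball a ρ := by
      apply (Metric.closedBall_subset_closedBall' (ε₂ := ρ / 3 + ρ / 2) _).trans
        (Metric.closedBall_subset_ball (by linarith))
      rw [Metric.mem_closedBall] at hb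
      linarith
    obtain ⟨w, hw⟩ := exists_ball_subset_image (by positivity) Metric.isOpen_ball hsub hF
    obtain ⟨w', hw', n, hn⟩ := exists_cosh_sq_eq_intCast w
    have hle : ρ / 3 * ‖deriv F b‖ / 48 ≤ 3 := by
      by_contra! hlt
      obtain ⟨z, hz, rfl⟩ := hw (mem_ball_iff_norm.mpr (hw'.trans hlt))
      exact homit z hz n hn
    rw [le_div_iff₀ hρ]
    linarith
  intro z hz
  have hsub : Metric.closedBall a (ρ / 2) ⊆ Metric.ball a ρ :=
    Metric.closedBall_subset_ball (by linarith)
  have h := Convex.norm_image_sub_le_of_norm_deriv_le (𝕜 := ℂ)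
    (fun x hx => hF.differentiableAt (Metric.isOpen_ball.mem_nhds (hsub hx))) hder
    (convex_closedBall a (ρ / 2)) (Metric.mem_closedBall_self (by positivity)) hz
  rw [mem_closedBall_iff_norm] at hz
  calc _ ≤ _ := h
    _ ≤ 432 / ρ * (ρ / 2) := by gcongr
    _ = 216 := by field_simp; norm_num

lemma norm_cosh_sq_le (w : ℂ) : ‖Complex.cosh w ^ 2‖ ≤ Real.exp (2 * |w.re|) := by
  have h : ‖Complex.cosh w‖ ≤ Real.exp |w.re| := by
    rw [Complex.cosh, norm_div, Complex.norm_two, div_le_iff₀ two_pos]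
    refine (norm_add_le _ _).trans ?_
    rw [Complex.norm_exp, Complex.norm_exp, Complex.neg_re]
    have h1 := Real.exp_le_exp.mpr (le_abs_self w.re)
    have h2 := Real.exp_le_exp.mpr (neg_le_abs w.re)
    linarith
  calc ‖Complex.cosh w ^ 2‖ = ‖Complex.cosh w‖ ^ 2 := norm_pow _ _
    _ ≤ Real.exp |w.re| ^ 2 := by gcongr
    _ = _ := by rw [← Real.exp_nat_mul]; norm_num

lemma exp_two_mul_abs_re_le (w : ℂ) :
    Real.exp (2 * |w.re|) ≤ 4 * (1 + ‖Complex.cosh w ^ 2‖) := by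
  have h1 : |Real.sinh w.re| ≤ ‖Complex.cosh w‖ := by
    rw [Complex.cosh, norm_div, Complex.norm_two, Real.sinh_eq, abs_div, abs_two]
    gcongr
    have := abs_norm_sub_norm_le (Complex.exp w) (-Complex.exp (-w))
    rwa [norm_neg, sub_neg_eq_add, Complex.norm_exp, Complex.norm_exp, Complex.neg_re] at this
  have h2 : Real.sinh w.re ^ 2 ≤ ‖Complex.cosh w ^ 2‖ := by
    rw [norm_pow, ← sq_abs (Real.sinh _)]
    gcongr
  have h3 : Real.exp |w.re| ≤ 2 * Real.cosh w.re := by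
    rw [← Real.cosh_abs, Real.cosh_eq]
    linarith [Real.exp_pos (-|w.re|)]
  calc Real.exp (2 * |w.re|) = Real.exp |w.re| ^ 2 := by rw [← Real.exp_nat_mul]; norm_num
    _ ≤ (2 * Real.cosh w.re) ^ 2 := by gcongr
    _ ≤ _ := by rw [mul_pow, Real.cosh_sq]; linarith

/-- Schottky's theorem in logarithmic form, still degenerate where `g a` is close to `0`. Writing
`g = exp (2πi H)` with `H = cosh² F`, the function `F` omits the points with integral `cosh²`. -/
lemma exists_log_norm_le :
    ∃ C : ℝ, 0 < C ∧ ∀ (g : ℂ → ℂ) (a : ℂ) (ρ : ℝ), 0 < ρ →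
      DifferentiableOn ℂ g (Metric.ball a ρ) →
      (∀ z ∈ Metric.ball a ρ, g z ≠ 0) → (∀ z ∈ Metric.ball a ρ, g z ≠ 1) →
      ∀ z ∈ Metric.closedBall a (ρ / 2), Real.log ‖g z‖ ≤ C * (1 + |Real.log ‖g a‖|) := by
  refine ⟨2 * Real.pi * (8 * Real.exp 432), by positivity, fun g a ρ hρ hg h0 h1 z hz => ?_⟩
  have ha : a ∈ Metric.ball a ρ := Metric.mem_ball_self hρ
  have hz' : z ∈ Metric.ball a ρ := Metric.closedBall_subset_ball (by linarith) hz
  obtain ⟨L, hLd, hL⟩ := exists_differentiableOn_exp_eq hg h0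
  -- The integer shift makes the real part of `H a` bounded.
  set k : ℤ := round (L a / (2 * Real.pi * Complex.I)).re
  set H : ℂ → ℂ := fun z => L z / (2 * Real.pi * Complex.I) - k with hHdef
  have hHL : ∀ z ∈ Metric.ball a ρ, Complex.exp (2 * Real.pi * Complex.I * H z) = g z := by
    intro z hz
    have : 2 * Real.pi * Complex.I * H z = L z - k * (2 * Real.pi * Complex.I) := by
      rw [hHdef]; field_simp [Complex.I_ne_zero]
    rw [this, Complex.exp_sub, Complex.exp_int_mul_two_pi_mul_I, div_one, hL z hz]
  have hHomit : ∀ z ∈ Metric.ball a ρ, ∀ n : ℤ, H z ≠ n := by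
    intro z hz n hn
    apply h1 z hz
    rw [← hHL z hz, hn, mul_comm, Complex.exp_int_mul_two_pi_mul_I]
  obtain ⟨F, hFd, hF⟩ := exists_differentiableOn_cosh_sq_eq (H := H)
    ((hLd.div_const _).sub_const _) (fun z hz => by simpa using hHomit z hz 0)
    (fun z hz => by simpa using hHomit z hz 1)
  have hFz := norm_sub_le_of_cosh_sq_ne_intCast hρ hFd
    (fun z hz n => by rw [hF z hz]; exact hHomit z hz n) z hz
  have hre : |(F z).re| ≤ 216 + |(F a).re| := by
    have h2 := (Complex.abs_re_le_norm (F z - F a)).trans hFz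
    rw [Complex.sub_re] at h2
    linarith [abs_sub_abs_le_abs_sub (F z).re (F a).re]
  have hlog : ∀ z ∈ Metric.ball a ρ, Real.log ‖g z‖ = -(2 * Real.pi * (H z).im) := by
    intro z hz
    rw [← hHL z hz, Complex.norm_exp, Real.log_exp]
    simp
  have hHz : ‖H z‖ ≤ Real.exp 432 * (4 * (1 + ‖H a‖)) := by
    rw [← hF z hz', ← hF a ha]
    calc _ ≤ Real.exp (2 * |(F z).re|) := norm_cosh_sq_le _
      _ ≤ Real.exp (432 + 2 * |(F a).re|) := Real.exp_le_exp.mpr (by linarith)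
      _ = Real.exp 432 * Real.exp (2 * |(F a).re|) := Real.exp_add _ _
      _ ≤ _ := by gcongr; exact exp_two_mul_abs_re_le _
  have hHa : ‖H a‖ ≤ 1 + |Real.log ‖g a‖| := by
    have hre : |(H a).re| ≤ 1 / 2 := by
      have := abs_sub_round (L a / (2 * Real.pi * Complex.I)).re
      simpa [hHdef] using this
    have him : |(H a).im| ≤ |Real.log ‖g a‖| := by
      rw [hlog a ha, abs_neg, abs_mul, abs_of_pos Real.two_pi_pos]
      nlinarith [abs_nonneg (H a).im, Real.pi_gt_three]
    linarith [Complex.norm_le_abs_re_add_abs_im (H a)]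
  calc Real.log ‖g z‖ = 2 * Real.pi * -(H z).im := by rw [hlog z hz']; ring
    _ ≤ 2 * Real.pi * ‖H z‖ := by
        gcongr
        exact (neg_le_abs _).trans (Complex.abs_im_le_norm _)
    _ ≤ 2 * Real.pi * (Real.exp 432 * (8 * (1 + |Real.log ‖g a‖|))) := by
        have hb : 4 * (1 + ‖H a‖) ≤ 8 * (1 + |Real.log ‖g a‖|) := by
          linarith [abs_nonneg (Real.log ‖g a‖)]
        exact mul_le_mul_of_nonneg_left (hHz.trans
          (mul_le_mul_of_nonneg_left hb (Real.exp_pos _).le)) Real.two_pi_pos.le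
    _ = _ := by ring

/-- **Schottky's theorem** with a polynomial bound: `2 + |g z| ≤ (2 + |g a|) ^ K` on the concentric
disc of half the radius, for `g` omitting `0` and `1`. When `|g a|` is small the previous estimate
is applied to `1 - g`. -/
theorem exists_log_two_add_norm_le :
    ∃ K : ℝ, 2 ≤ K ∧ ∀ (g : ℂ → ℂ) (a : ℂ) (ρ : ℝ), 0 < ρ →
      DifferentiableOn ℂ g (Metric.ball a ρ) →
      (∀ z ∈ Metric.ball a ρ, g z ≠ 0) → (∀ z ∈ Metric.ball a ρ, g z ≠ 1) →
      ∀ z ∈ Metric.closedBall a (ρ / 2),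
        Real.log (2 + ‖g z‖) ≤ K * Real.log (2 + ‖g a‖) := by
  obtain ⟨C, hC, hmain⟩ := exists_log_norm_le
  refine ⟨4 + 3 * C, by linarith, fun g a ρ hρ hg h0 h1 z hz => ?_⟩
  have ha : a ∈ Metric.ball a ρ := Metric.mem_ball_self hρ
  have hlog2 : (1 : ℝ) / 2 ≤ Real.log 2 := by linarith [Real.log_two_gt_d9]
  have hlog2a : Real.log 2 ≤ Real.log (2 + ‖g a‖) :=
    Real.log_le_log two_pos (by linarith [norm_nonneg (g a)])
  have hlog4 : Real.log 4 = 2 * Real.log 2 := by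
    rw [show (4 : ℝ) = 2 ^ 2 by norm_num, Real.log_pow]; norm_num
  -- A bound `y ≤ 4 max (1, x)` with `log x ≤ C B` and `B ≤ 3 log (2 + |g a|)` suffices.
  have hfin : ∀ x y B : ℝ, 0 ≤ B → 0 < y → y ≤ 4 * max 1 x → Real.log x ≤ C * B →
      B ≤ 3 * Real.log (2 + ‖g a‖) → Real.log y ≤ (4 + 3 * C) * Real.log (2 + ‖g a‖) := by
    intro x y B hB hy hyx hxB hB3
    have h2 : Real.log (max 1 x) ≤ C * B := by
      rcases max_cases 1 x with ⟨h, -⟩ | ⟨h, -⟩ <;> rw [h]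
      · rw [Real.log_one]; positivity
      · exact hxB
    have h3 := Real.log_le_log hy hyx
    rw [Real.log_mul (by norm_num) (by positivity), hlog4] at h3
    have h4 : C * B ≤ C * (3 * Real.log (2 + ‖g a‖)) := by gcongr
    linarith
  rcases le_or_gt (1 / 2) ‖g a‖ with hga | hga
  · have hpos : 0 < ‖g a‖ := by linarith
    refine hfin ‖g z‖ _ _ (by positivity) (by positivity) ?_ (hmain g a ρ hρ hg h0 h1 z hz) ?_
    · linarith [le_max_left 1 ‖g z‖, le_max_right 1 ‖g z‖]
    · have h2 : |Real.log ‖g a‖| ≤ Real.log (2 + ‖g a‖) := by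
        rw [abs_le]
        constructor
        · have := Real.log_le_log (by norm_num) hga
          rw [one_div, Real.log_inv] at this
          linarith
        · exact Real.log_le_log hpos (by linarith)
      linarith
  · have hlow : 1 / 2 ≤ ‖1 - g a‖ := by
      have := norm_sub_norm_le 1 (g a)
      rw [norm_one] at this; linarith
    have hupp : ‖1 - g a‖ ≤ 2 := by
      have := norm_sub_le 1 (g a)
      rw [norm_one] at this; linarith
    refine hfin ‖1 - g z‖ _ _ (by positivity) (by positivity) ?_
      (hmain (fun z => 1 - g z) a ρ hρ (hg.const_sub 1)
        (fun z hz => sub_ne_zero.mpr (h1 z hz).symm)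
        (fun z hz h => h0 z hz (by simpa using h)) z hz) ?_
    · have : ‖g z‖ ≤ 1 + ‖1 - g z‖ := by
        have := norm_sub_le 1 (1 - g z)
        rwa [sub_sub_cancel, norm_one] at this
      linarith [le_max_left 1 ‖1 - g z‖, le_max_right 1 ‖1 - g z‖]
    · have h2 : |Real.log ‖1 - g a‖| ≤ Real.log 2 := by
        rw [abs_le]
        constructor
        · have := Real.log_le_log (by norm_num) hlow
          rwa [one_div, Real.log_inv] at this
        · exact Real.log_le_log (by linarith) hupp
      linarith

/-- Chaining Schottky's theorem along a circle: `g` is assumed holomorphic and to omit `0` and `1`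
on an annulus wide enough to contain the discs of radius `s / 2` centred on the circle. -/
theorem exists_log_two_add_norm_le_on_circle :
    ∃ K : ℝ, 2 ≤ K ∧ ∀ (g : ℂ → ℂ) (s : ℝ), 0 < s →
      DifferentiableOn ℂ g (openAnnulus (s / 2) (3 * s / 2)) →
      (∀ z ∈ openAnnulus (s / 2) (3 * s / 2), g z ≠ 0) →
      (∀ z ∈ openAnnulus (s / 2) (3 * s / 2), g z ≠ 1) →
      ∀ z w : ℂ, ‖z‖ = s → ‖w‖ = s →
        Real.log (2 + ‖g z‖) ≤ K * Real.log (2 + ‖g w‖) := by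
  obtain ⟨K, hK, hmain⟩ := exists_log_two_add_norm_le
  refine ⟨K ^ 16, (by linarith : 2 ≤ K).trans (le_self_pow₀ (by linarith) (by norm_num)),
    fun g s hs hg h0 h1 z w hz hw => ?_⟩
  have hsub : ∀ a : ℂ, ‖a‖ = s → Metric.ball a (s / 2) ⊆ openAnnulus (s / 2) (3 * s / 2) := by
    intro a ha z hz
    rw [mem_ball_iff_norm] at hz
    have h2 := norm_sub_norm_le z a
    have h3 := norm_sub_norm_le a z
    rw [norm_sub_rev] at h3
    exact ⟨by linarith, by linarith⟩
  have hw0 : w ≠ 0 := by rw [← norm_pos_iff, hw]; exact hs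
  set θ : ℝ := (z / w).arg
  -- `π / 16 < 1 / 4`, so that consecutive points are at distance at most `s / 4`.
  set p : ℕ → ℂ := fun k => w * Complex.exp ((k * (θ / 16) : ℝ) * Complex.I)
  have hpn : ∀ k, ‖p k‖ = s := fun k => by
    simp only [p, norm_mul, Complex.norm_exp_ofReal_mul_I, hw, mul_one]
  have hstep : ∀ k, ‖p (k + 1) - p k‖ ≤ s / 2 / 2 := by
    intro k
    have he : p (k + 1) - p k = p k * (Complex.exp (Complex.I * (θ / 16 : ℝ)) - 1) := by
      simp only [p]
      rw [mul_sub, mul_assoc, ← Complex.exp_add, mul_one]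
      congr 3
      push_cast; ring
    rw [he, norm_mul, hpn]
    have h2 := Real.norm_exp_I_mul_ofReal_sub_one_le (x := θ / 16)
    rw [Real.norm_eq_abs, abs_div, abs_of_pos (by norm_num : (0 : ℝ) < 16)] at h2
    have h3 : |θ| ≤ Real.pi := Complex.abs_arg_le_pi _
    have h4 := Real.pi_lt_d2
    calc _ ≤ s * (1 / 4) := by gcongr; linarith
      _ = _ := by ring
  have hind : ∀ k : ℕ, Real.log (2 + ‖g (p k)‖) ≤ K ^ k * Real.log (2 + ‖g w‖) := by
    intro k
    induction k with
    | zero => simp [p]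
    | succ k ih =>
      have h2 := hmain g (p k) (s / 2) (by positivity) (hg.mono (hsub _ (hpn k)))
        (fun z hz => h0 z (hsub _ (hpn k) hz)) (fun z hz => h1 z (hsub _ (hpn k) hz))
        (p (k + 1)) (mem_closedBall_iff_norm.mpr (hstep k))
      calc _ ≤ _ := h2
        _ ≤ K * (K ^ k * Real.log (2 + ‖g w‖)) := by gcongr
        _ = _ := by ring
  have hp : p 16 = z := by
    have h2 := Complex.norm_mul_exp_arg_mul_I (z / w)
    rw [norm_div, hz, hw, div_self hs.ne'] at h2
    simp only [p]
    have : (((16 : ℕ) : ℝ) * (θ / 16) : ℝ) = θ := by push_cast; ring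
    rw [this]
    have h3 : Complex.exp (θ * Complex.I) = z / w := by simpa using h2
    rw [h3, mul_div_cancel₀ _ hw0]
  rw [← hp]
  exact hind 16

/-- An exponent for Schottky's theorem on circles; it serves as the constant `C₀`. -/
noncomputable def schottkyExponent : ℝ := Classical.choose exists_log_two_add_norm_le_on_circle

lemma two_le_schottkyExponent : 2 ≤ schottkyExponent :=
  (Classical.choose_spec exists_log_two_add_norm_le_on_circle).1

lemma log_two_add_norm_le_on_circle {g : ℂ → ℂ} {s : ℝ} (hs : 0 < s)
    (hg : DifferentiableOn ℂ g (openAnnulus (s / 2) (3 * s / 2)))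
    (h0 : ∀ z ∈ openAnnulus (s / 2) (3 * s / 2), g z ≠ 0)
    (h1 : ∀ z ∈ openAnnulus (s / 2) (3 * s / 2), g z ≠ 1)
    {z w : ℂ} (hz : ‖z‖ = s) (hw : ‖w‖ = s) :
    Real.log (2 + ‖g z‖) ≤ schottkyExponent * Real.log (2 + ‖g w‖) :=
  (Classical.choose_spec exists_log_two_add_norm_le_on_circle).2 g s hs hg h0 h1 z w hz hw

/-! ### Maximum and minimum modulus -/

lemma norm_le_maxModulus_of_norm_eq {f : ℂ → ℂ} (hf : Continuous f) {r : ℝ} {z : ℂ}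
    (hz : ‖z‖ = r) : ‖f z‖ ≤ maxModulus f r :=
  le_csSup ((isCompact_sphere (0 : ℂ) r).bddAbove_image hf.norm.continuousOn)
    ⟨z, by simpa using hz, rfl⟩

lemma exists_norm_eq_maxModulus {f : ℂ → ℂ} (hf : Continuous f) {r : ℝ} (hr : 0 ≤ r) :
    ∃ z : ℂ, ‖z‖ = r ∧ ‖f z‖ = maxModulus f r := by
  obtain ⟨z, hz, h⟩ := (isCompact_sphere (0 : ℂ) r).exists_sSup_image_eq
    (NormedSpace.sphere_nonempty.mpr hr) hf.norm.continuousOn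
  exact ⟨z, by simpa using hz, h.symm⟩

lemma exists_norm_eq_minModulus {f : ℂ → ℂ} (hf : Continuous f) {r : ℝ} (hr : 0 ≤ r) :
    ∃ z : ℂ, ‖z‖ = r ∧ ‖f z‖ = minModulus f r := by
  obtain ⟨z, hz, h⟩ := (isCompact_sphere (0 : ℂ) r).exists_sInf_image_eq
    (NormedSpace.sphere_nonempty.mpr hr) hf.norm.continuousOn
  exact ⟨z, by simpa using hz, h.symm⟩

lemma norm_le_maxModulus {f : ℂ → ℂ} (hf : Differentiable ℂ f) {r : ℝ} (hr : 0 < r) {z : ℂ}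
    (hz : ‖z‖ ≤ r) : ‖f z‖ ≤ maxModulus f r := by
  refine Complex.norm_le_of_forall_mem_frontier_norm_le (U := Metric.ball 0 r)
    Metric.isBounded_ball hf.diffContOnCl (fun w hw => ?_) ?_
  · rw [frontier_ball _ hr.ne'] at hw
    exact norm_le_maxModulus_of_norm_eq hf.continuous (by simpa using hw)
  · rw [closure_ball _ hr.ne']
    simpa using hz

lemma maxModulus_mono {f : ℂ → ℂ} (hf : Differentiable ℂ f) {r s : ℝ} (hr : 0 < r)
    (hrs : r ≤ s) : maxModulus f r ≤ maxModulus f s := by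
  obtain ⟨z, hz, h⟩ := exists_norm_eq_maxModulus hf.continuous hr.le
  rw [← h]
  exact norm_le_maxModulus hf (hr.trans_le hrs) (hz.trans_le hrs)

lemma IsTranscendentalEntire.not_eqOn_ball {f : ℂ → ℂ} (hf : IsTranscendentalEntire f) {R : ℝ}
    (hR : 0 < R) (c : ℂ) : ¬ ∀ z ∈ Metric.ball (0 : ℂ) R, f z = c := by
  intro h
  have hfan : AnalyticOnNhd ℂ f Set.univ :=
    Complex.analyticOnNhd_univ_iff_differentiable.mpr hf.1
  have heq : f = fun _ => c := hfan.eq_of_eventuallyEq (z₀ := 0) analyticOnNhd_const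
    (Filter.eventually_of_mem (Metric.ball_mem_nhds _ hR) h)
  exact hf.2 ⟨Polynomial.C c, fun z => by simp [heq]⟩

lemma IsTranscendentalEntire.maxModulus_pos {f : ℂ → ℂ} (hf : IsTranscendentalEntire f) {r : ℝ}
    (hr : 0 < r) : 0 < maxModulus f r := by
  by_contra! h
  refine hf.not_eqOn_ball hr 0 fun z hz => norm_le_zero_iff.mp ?_
  exact (norm_le_maxModulus hf.1 hr (by simpa using (Metric.ball_subset_closedBall hz))).trans h

lemma IsTranscendentalEntire.maxModulus_lt_two_mul {f : ℂ → ℂ} (hf : IsTranscendentalEntire f)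
    {r : ℝ} (hr : 0 < r) : maxModulus f r < maxModulus f (2 * r) := by
  by_contra! h
  obtain ⟨w, hw, hwm⟩ := exists_norm_eq_maxModulus hf.1.continuous hr.le
  refine hf.not_eqOn_ball (R := 2 * r) (by positivity) _
    (Complex.eq_const_of_exists_le hf.1.differentiableOn hr.le (by linarith) fun z hz =>
      ⟨w, by simpa using hw.le, ?_⟩)
  rw [hwm]
  exact (norm_le_maxModulus hf.1 (by positivity)
    (by simpa using (Metric.ball_subset_closedBall hz))).trans h

lemma IsTranscendentalEntire.coverLambda_pos {f : ℂ → ℂ} (hf : IsTranscendentalEntire f)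
    {r : ℝ} (hr : 0 < r) : 0 < coverLambda f r := by
  have := (one_lt_div (hf.maxModulus_pos hr)).mpr (hf.maxModulus_lt_two_mul hr)
  rw [coverLambda]
  linarith

/-! ### Growth of the maximum modulus -/

/-- Splitting off the Taylor polynomial of degree `n` of an entire function. -/
lemma exists_eq_polynomial_add_pow_mul {f : ℂ → ℂ} (hf : Differentiable ℂ f) (n : ℕ) :
    ∃ (p : Polynomial ℂ) (A : ℝ) (g : ℂ → ℂ), 0 ≤ A ∧ Differentiable ℂ g ∧
      (∀ z, f z = p.eval z + z ^ (n + 1) * g z) ∧ ∀ z, 1 ≤ ‖z‖ → ‖p.eval z‖ ≤ A * ‖z‖ ^ n := by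
  have hsplit : ∀ h : ℂ → ℂ, Differentiable ℂ h →
      ∃ k : ℂ → ℂ, Differentiable ℂ k ∧ ∀ z, h z = h 0 + z * k z := by
    intro h hh
    refine ⟨dslope h 0, ?_, fun z => ?_⟩
    · rw [← differentiableOn_univ] at hh ⊢
      exact (Complex.differentiableOn_dslope Filter.univ_mem).mpr hh
    · have := sub_smul_dslope h 0 z
      rw [sub_zero, smul_eq_mul] at this
      rw [this]; ring
  induction n with
  | zero =>
    obtain ⟨k, hk, h⟩ := hsplit f hf
    exact ⟨Polynomial.C (f 0), ‖f 0‖, k, norm_nonneg _, hk, by simpa using h, by simp⟩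
  | succ n ih =>
    obtain ⟨p, A, g, hA, hg, hfg, hp⟩ := ih
    obtain ⟨k, hk, h⟩ := hsplit g hg
    refine ⟨p + Polynomial.C (g 0) * Polynomial.X ^ (n + 1), A + ‖g 0‖, k, by positivity, hk,
      fun z => ?_, fun z hz => ?_⟩
    · rw [hfg z, h z]
      simp only [Polynomial.eval_add, Polynomial.eval_mul, Polynomial.eval_C, Polynomial.eval_pow,
        Polynomial.eval_X]
      ring
    · simp only [Polynomial.eval_add, Polynomial.eval_mul, Polynomial.eval_C, Polynomial.eval_pow,
        Polynomial.eval_X]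
      calc _ ≤ ‖p.eval z‖ + ‖g 0 * z ^ (n + 1)‖ := norm_add_le _ _
        _ ≤ A * ‖z‖ ^ (n + 1) + ‖g 0‖ * ‖z‖ ^ (n + 1) := by
          rw [norm_mul, norm_pow]
          gcongr
          exact (hp z hz).trans (by gcongr; simp)
        _ = _ := by ring

/-- For `f = p + z ^ (n + 1) g` with `deg p ≤ n`, the second term dominates, and its maximum modulus
grows at least by the factor `2 ^ (n + 1)` from `r` to `2 r`. -/
lemma IsTranscendentalEntire.eventually_two_pow_mul_maxModulus_le {f : ℂ → ℂ}
    (hf : IsTranscendentalEntire f) (n : ℕ) :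
    ∀ᶠ r in atTop, 2 ^ n * maxModulus f r ≤ maxModulus f (2 * r) := by
  obtain ⟨p, A, g, hA, hg, hfg, hp⟩ := exists_eq_polynomial_add_pow_mul hf.1 n
  obtain ⟨z₀, hz₀⟩ : ∃ z₀, g z₀ ≠ 0 := by
    by_contra! h
    exact hf.2 ⟨p, fun z => by rw [hfg z, h z]; ring⟩
  have hμ : 0 < ‖g z₀‖ := norm_pos_iff.mpr hz₀
  filter_upwards [eventually_ge_atTop 1, eventually_ge_atTop ‖z₀‖,
    eventually_ge_atTop (4 * A / ‖g z₀‖)] with r hr1 hr2 hr3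
  have hr : 0 < r := by linarith
  rw [div_le_iff₀ hμ] at hr3
  have hG : ‖g z₀‖ ≤ maxModulus g r := norm_le_maxModulus hg hr hr2
  -- `|f|` and `|z ^ (n + 1) g|` differ by at most `A |z| ^ n` on circles.
  have hdiff : ∀ z : ℂ, 1 ≤ ‖z‖ → |‖f z‖ - ‖z‖ ^ (n + 1) * ‖g z‖| ≤ A * ‖z‖ ^ n := by
    intro z hz
    have h1 := abs_norm_sub_norm_le (f z) (z ^ (n + 1) * g z)
    rw [hfg z, add_sub_cancel_right, ← hfg z, norm_mul, norm_pow] at h1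
    exact h1.trans (hp z hz)
  have hupper : maxModulus f r ≤ r ^ (n + 1) * maxModulus g r + A * r ^ n := by
    obtain ⟨z, hz, h⟩ := exists_norm_eq_maxModulus hf.1.continuous hr.le
    have h1 := (abs_le.mp (hdiff z (hz.symm ▸ hr1))).2
    have h2 : r ^ (n + 1) * ‖g z‖ ≤ r ^ (n + 1) * maxModulus g r := by
      gcongr; exact norm_le_maxModulus hg hr hz.le
    rw [hz] at h1
    linarith
  have hlower : ∀ t : ℝ, r ≤ t → t ^ (n + 1) * maxModulus g r - A * t ^ n ≤ maxModulus f t := by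
    intro t ht
    obtain ⟨z, hz, h⟩ := exists_norm_eq_maxModulus hg.continuous (hr.le.trans ht)
    have h1 := (abs_le.mp (hdiff z (by linarith))).1
    rw [hz, h] at h1
    have h2 : t ^ (n + 1) * maxModulus g r ≤ t ^ (n + 1) * maxModulus g t := by
      have := maxModulus_mono hg hr ht
      have := hr.le.trans ht
      gcongr
    linarith [norm_le_maxModulus_of_norm_eq hf.1.continuous hz]
  have hl1 := hlower r le_rfl
  have hl2 := hlower (2 * r) (by linarith)
  have hA3 : 3 * (A * r ^ n) ≤ maxModulus f r := by
    have h1 : 4 * A * r ^ n ≤ r ^ (n + 1) * maxModulus g r := by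
      calc 4 * A * r ^ n ≤ r * ‖g z₀‖ * r ^ n := by gcongr
        _ = r ^ (n + 1) * ‖g z₀‖ := by ring
        _ ≤ _ := by gcongr
    linarith
  have h2n : (0 : ℝ) < 2 ^ n := by positivity
  rw [mul_pow, mul_pow, pow_succ (2 : ℝ) n] at hl2
  have e1 := mul_le_mul_of_nonneg_left hA3 h2n.le
  have e2 := mul_le_mul_of_nonneg_left hupper h2n.le
  linarith

lemma IsTranscendentalEntire.tendsto_coverLambda {f : ℂ → ℂ} (hf : IsTranscendentalEntire f) :
    Tendsto (coverLambda f) atTop atTop := by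
  refine tendsto_atTop.mpr fun b => ?_
  obtain ⟨n, hn⟩ := pow_unbounded_of_one_lt (2 * b + 1) one_lt_two
  filter_upwards [hf.eventually_two_pow_mul_maxModulus_le n, eventually_gt_atTop 0] with r hr hr0
  have := (le_div_iff₀ (hf.maxModulus_pos hr0)).mpr hr
  rw [coverLambda]
  linarith

lemma IsTranscendentalEntire.tendsto_coverEps {f : ℂ → ℂ} (hf : IsTranscendentalEntire f)
    {C₀ C₁ : ℝ} (h₀ : 0 < C₀) (h₁ : 0 < C₁) : Tendsto (coverEps C₀ C₁ f) atTop (𝓝 0) :=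
  tendsto_const_nhds.div_atTop
    ((tendsto_rpow_atTop (by positivity : 0 < 1 / C₀)).comp
      (hf.tendsto_coverLambda.const_mul_atTop h₁))

/-! ### Covering of discs and annuli -/

/-- A nonempty bounded set has an element of modulus at least half of every other modulus. -/
lemma exists_mem_forall_norm_le_two_mul {O : Set ℂ} (hne : O.Nonempty) {M : ℝ}
    (hM : ∀ v ∈ O, ‖v‖ ≤ M) : ∃ u ∈ O, ∀ v ∈ O, ‖v‖ ≤ 2 * ‖u‖ := by
  have hbdd : BddAbove (norm '' O) := ⟨M, by rintro _ ⟨v, hv, rfl⟩; exact hM v hv⟩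
  have hle : ∀ v ∈ O, ‖v‖ ≤ sSup (norm '' O) := fun v hv => le_csSup hbdd ⟨v, hv, rfl⟩
  obtain ⟨u₀, hu₀⟩ := hne
  rcases le_or_gt (sSup (norm '' O)) 0 with h | h
  · exact ⟨u₀, hu₀, fun v hv => by linarith [hle v hv, norm_nonneg u₀]⟩
  · obtain ⟨_, ⟨u, hu, rfl⟩, hlt⟩ := exists_lt_of_lt_csSup (Set.image_nonempty.mpr ⟨u₀, hu₀⟩)
      (half_lt_self h)
    exact ⟨u, hu, fun v hv => by linarith [hle v hv]⟩

/-- The choice of `C₁ = 16`: Schottky's bound, `λ < (8 / ε) ^ C₀`, is incompatible with the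
definition of `ε`. -/
lemma schottkyExponent_mul_log_le {f : ℂ → ℂ} {r : ℝ} (hlam : 0 < coverLambda f r) :
    schottkyExponent * Real.log (8 / coverEps schottkyExponent 16 f r) ≤
      Real.log (coverLambda f r) := by
  have hK := two_le_schottkyExponent
  have hlog : ∀ n : ℕ, Real.log (2 ^ n) = n * Real.log 2 := fun n => Real.log_pow _ _
  have h8 : Real.log 8 = 3 * Real.log 2 := by
    rw [show (8 : ℝ) = 2 ^ 3 by norm_num, hlog]; norm_num
  have h16 : Real.log 16 = 4 * Real.log 2 := by
    rw [show (16 : ℝ) = 2 ^ 4 by norm_num, hlog]; norm_num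
  have h32 : Real.log (2 * 16) = 5 * Real.log 2 := by
    rw [show (2 * 16 : ℝ) = 2 ^ 5 by norm_num, hlog]; norm_num
  have hpos : 0 < 16 * coverLambda f r := by positivity
  have hrpow : 0 < (16 * coverLambda f r) ^ (1 / schottkyExponent) := Real.rpow_pos_of_pos hpos _
  rw [coverEps, Real.log_div (by norm_num) (by positivity), Real.log_div (by norm_num) hrpow.ne',
    Real.log_rpow hpos, Real.log_mul (by norm_num) hlam.ne', h8, h16, h32]
  have he : schottkyExponent * (3 * Real.log 2 - (5 * Real.log 2 -
      1 / schottkyExponent * (4 * Real.log 2 + Real.log (coverLambda f r)))) =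
      Real.log (coverLambda f r) - 2 * (schottkyExponent - 2) * Real.log 2 := by
    field_simp; ring
  rw [he]
  have : 0 ≤ 2 * (schottkyExponent - 2) * Real.log 2 :=
    mul_nonneg (by linarith) (Real.log_nonneg one_le_two)
  linarith

theorem IsTranscendentalEntire.exists_ball_diff_ball_subset_image {f : ℂ → ℂ}
    (hf : IsTranscendentalEntire f) {r s : ℝ} (hr : 0 < r) (hs : s ∈ Set.Ioo (2 * r) (4 * r))
    (hm : minModulus f s ≤ 1) :
    Metric.ball (0 : ℂ) (maxModulus f r) ⊆ f '' openAnnulus r (8 * r) ∨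
      ∃ w₁ ∈ Metric.ball (0 : ℂ) (maxModulus f r), Metric.ball (0 : ℂ) (maxModulus f r) \
        Metric.ball w₁ (coverEps schottkyExponent 16 f r * max ‖w₁‖ 1) ⊆
          f '' openAnnulus r (8 * r) := by
  set M := maxModulus f r with hM
  set ε := coverEps schottkyExponent 16 f r with hε
  rcases (Metric.ball (0 : ℂ) M \ f '' openAnnulus r (8 * r)).eq_empty_or_nonempty with he | hne
  · exact Or.inl (Set.sdiff_eq_empty.mp he)
  right
  obtain ⟨w₁, ⟨hw₁M, hw₁⟩, hw₁max⟩ := exists_mem_forall_norm_le_two_mul hne (M := M)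
    (fun v hv => (mem_ball_zero_iff.mp hv.1).le)
  refine ⟨w₁, hw₁M, ?_⟩
  rintro v ⟨hvM, hvε⟩
  by_contra hv
  have hv2 := hw₁max v ⟨hvM, hv⟩
  rw [mem_ball_zero_iff] at hw₁M hvM
  rw [mem_ball_iff_norm, not_lt] at hvε
  have hM0 : 0 < M := hf.maxModulus_pos hr
  have hlam : 0 < coverLambda f r := hf.coverLambda_pos hr
  have hε0 : 0 < ε := by
    have : 0 < (16 * coverLambda f r) ^ (1 / schottkyExponent) :=
      Real.rpow_pos_of_pos (by positivity) _
    rw [hε, coverEps]; positivity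
  set δ := max ‖w₁‖ 1
  have hδ1 : 1 ≤ δ := le_max_right _ _
  have hδw : ‖w₁‖ ≤ δ := le_max_left _ _
  have hd0 : 0 < ‖v - w₁‖ := lt_of_lt_of_le (by positivity) hvε
  have hdne : v - w₁ ≠ 0 := norm_pos_iff.mp hd0
  -- The near-maximality of `|w₁|` among the omitted values forces `ε` to be bounded.
  have hε3 : ε ≤ 3 := by
    have h1 := norm_sub_le v w₁
    exact le_of_mul_le_mul_right (by linarith : ε * δ ≤ 3 * δ) (by linarith)
  have hs0 : 0 < s := by linarith [hs.1]
  have hsub : openAnnulus (s / 2) (3 * s / 2) ⊆ openAnnulus r (8 * r) := fun z hz =>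
    ⟨by linarith [hz.1, hs.1], by linarith [hz.2, hs.2]⟩
  obtain ⟨ζ, hζ, hfζ⟩ := exists_norm_eq_minModulus hf.1.continuous hs0.le
  obtain ⟨z, hz, hfz⟩ := exists_norm_eq_maxModulus hf.1.continuous hs0.le
  have hschottky := log_two_add_norm_le_on_circle (g := fun z => (f z - w₁) / (v - w₁)) hs0
    ((hf.1.sub_const w₁).div_const _).differentiableOn
    (fun z hz h => hw₁ ⟨z, hsub hz, sub_eq_zero.mp ((div_eq_zero_iff.mp h).resolve_right hdne)⟩)
    (fun z hz h => hv ⟨z, hsub hz, sub_left_injective ((div_eq_one_iff_eq hdne).mp h)⟩) hz hζ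
  have hsmall : 2 + ‖(f ζ - w₁) / (v - w₁)‖ ≤ 8 / ε := by
    have h1 : ‖f ζ - w₁‖ ≤ 2 * δ := by linarith [norm_sub_le (f ζ) w₁]
    have h2 : ‖(f ζ - w₁) / (v - w₁)‖ ≤ 2 / ε := by
      rw [norm_div]
      calc _ ≤ 2 * δ / (ε * δ) := by gcongr
        _ = 2 / ε := by field_simp
    have h3 : 2 ≤ 6 / ε := by rw [le_div_iff₀ hε0]; linarith
    calc _ ≤ 6 / ε + 2 / ε := add_le_add h3 h2
      _ = 8 / ε := by ring
  have hlarge : coverLambda f r ≤ ‖(f z - w₁) / (v - w₁)‖ := by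
    have h1 : maxModulus f (2 * r) - M ≤ ‖f z - w₁‖ := by
      have := maxModulus_mono hf.1 (by positivity : 0 < 2 * r) hs.1.le
      linarith [norm_sub_norm_le (f z) w₁]
    have h2 : ‖v - w₁‖ ≤ 2 * M := by linarith [norm_sub_le v w₁]
    have he : coverLambda f r = (maxModulus f (2 * r) - M) / (2 * M) := by
      rw [coverLambda, ← hM]; field_simp
    rw [norm_div, he]
    gcongr
  have h1 : Real.log (coverLambda f r) < Real.log (2 + ‖(f z - w₁) / (v - w₁)‖) :=
    Real.log_lt_log hlam (by linarith)
  have h2 : schottkyExponent * Real.log (2 + ‖(f ζ - w₁) / (v - w₁)‖) ≤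
      schottkyExponent * Real.log (8 / ε) := by
    have := two_le_schottkyExponent
    gcongr
  linarith [schottkyExponent_mul_log_le hlam]

/-- A disc that is small relative to its centre cannot meet two annuli that are separated by a
factor of two, so one of them avoids it. -/
lemma openAnnulus_subset_or_of_ball_diff_ball_subset {X : Set ℂ} {M ε : ℝ} (hε : ε ≤ 1 / 8) {w₁ : ℂ}
    (hX : Metric.ball (0 : ℂ) M \ Metric.ball w₁ (ε * max ‖w₁‖ 1) ⊆ X) {S S' T T' : ℝ}
    (hS : 2 < S) (hSS' : S < S') (hTT' : T < T') (hT' : T' ≤ M) (hS'T : S' ≤ (1 / 2) * T) :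
    openAnnulus S S' ⊆ X ∨ openAnnulus T T' ⊆ X := by
  by_contra! h
  obtain ⟨⟨u, hu, huX⟩, ⟨v, hv, hvX⟩⟩ := And.imp Set.not_subset.mp Set.not_subset.mp h
  have hball : ∀ x, ‖x‖ < M → x ∉ X → ‖x - w₁‖ < ε * max ‖w₁‖ 1 := by
    intro x hx hxX
    by_contra hlt
    exact hxX (hX ⟨mem_ball_zero_iff.mpr hx, by rwa [mem_ball_iff_norm]⟩)
  have hmax : ε * max ‖w₁‖ 1 ≤ 1 / 8 * (‖w₁‖ + 1) := by
    have h1 : max ‖w₁‖ 1 ≤ ‖w₁‖ + 1 := max_le (by linarith) (by linarith [norm_nonneg w₁])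
    calc _ ≤ 1 / 8 * max ‖w₁‖ 1 := by gcongr
      _ ≤ _ := by gcongr
  have hu1 := hball u (by linarith [hu.2]) huX
  have hv1 := hball v (by linarith [hv.2]) hvX
  have h1 := norm_sub_norm_le w₁ u
  rw [norm_sub_rev] at h1
  have h2 := norm_sub_norm_le v w₁
  linarith [hu.1, hu.2, hv.1]

theorem theorem2p2 :
    ∃ C₀ C₁ : ℝ, 1 < C₀ ∧ 1 < C₁ ∧
      ∀ f : ℂ → ℂ, IsTranscendentalEntire f →
        (∀ r : ℝ, 0 < r →
          (∃ s ∈ Set.Ioo (2 * r) (4 * r), minModulus f s ≤ 1) →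
            Metric.ball (0 : ℂ) (maxModulus f r) ⊆ f '' openAnnulus r (8 * r) ∨
            ∃ w₁ ∈ Metric.ball (0 : ℂ) (maxModulus f r),
              Metric.ball (0 : ℂ) (maxModulus f r) \
                  Metric.ball w₁ (coverEps C₀ C₁ f r * max ‖w₁‖ 1) ⊆
                f '' openAnnulus r (8 * r)) ∧
        Tendsto (coverEps C₀ C₁ f) atTop (𝓝 0) ∧
        ∃ R₂ : ℝ, 0 < R₂ ∧
          ∀ r : ℝ, R₂ < r →
            (∃ s ∈ Set.Ioo (2 * r) (4 * r), minModulus f s ≤ 1) →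
              ∀ S S' T T' : ℝ, 2 < S → S < S' → T < T' → T' ≤ maxModulus f r →
                S' ≤ (1 / 2) * T →
                  openAnnulus S S' ⊆ f '' openAnnulus r (8 * r) ∨
                  openAnnulus T T' ⊆ f '' openAnnulus r (8 * r) := by
  have hK := two_le_schottkyExponent
  refine ⟨schottkyExponent, 16, by linarith, by norm_num, fun f hf => ?_⟩
  have hlim := hf.tendsto_coverEps (C₀ := schottkyExponent) (C₁ := 16) (by linarith) (by norm_num)
  refine ⟨fun r hr ⟨s, hs, hm⟩ => hf.exists_ball_diff_ball_subset_image hr hs hm, hlim, ?_⟩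
  obtain ⟨R, hR⟩ := eventually_atTop.mp (hlim.eventually_le_const (by norm_num : (0 : ℝ) < 1 / 8))
  refine ⟨max R 1, by positivity, fun r hr ⟨s, hs, hm⟩ S S' T T' hS hSS' hTT' hT' hS'T => ?_⟩
  have hε := hR r ((le_max_left _ _).trans hr.le)
  have hr0 : 0 < r := zero_lt_one.trans ((le_max_right _ _).trans_lt hr)
  have hcover : ∃ w₁ : ℂ, Metric.ball (0 : ℂ) (maxModulus f r) \
      Metric.ball w₁ (coverEps schottkyExponent 16 f r * max ‖w₁‖ 1) ⊆
        f '' openAnnulus r (8 * r) := by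
    rcases hf.exists_ball_diff_ball_subset_image hr0 hs hm with h | ⟨w₁, -, h⟩
    · exact ⟨0, Set.sdiff_subset.trans h⟩
    · exact ⟨w₁, h⟩
  obtain ⟨w₁, h⟩ := hcover
  exact openAnnulus_subset_or_of_ball_diff_ball_subset hε h hS hSS' hTT' hT' hS'T
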